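/- Let $(B,g_B)$ and $(F,g_F)$ be (nonempty) smooth Riemannian manifolds with $\dim B=n_1\ge 2$ and $\dim F=n_2\ge 2$, let $f:B\to(0,\infty)$ be a smooth function, and let $M=B\times_f F$ be the warped product, that is, $B\times F$ with the metric $g=g_B\oplus f^2g_F$. Let $P$ be a smooth vector field on $M$ tangent to $B$ (its component along $F$ vanishes everywhere), let $\pi(X)=g(X,P)$, and let $$\overline\nabla_XY=\nabla_XY+\pi(Y)X$$ be the associated semi-symmetric non-metric connection, where $\nabla$ is the Levi-Civita connection of $(M,g)$. Let $\overline R(X,Y)=\overline\nabla_X\overline\nabla_Y-\overline\nabla_Y\overline\nabla_X-\overline\nabla_{[X,Y]}$ be its curvature and $\overline{\mathrm{Ric}}(X,Y)=\sum_k g(\overline R(X,E_k)Y,E_k)$, with $(E_k)$ a $g$-orthonormal frame, its Ricci curvature. Suppose that $M$ is quasi-Einstein with respect to $\overline\nabla$: there are real constants $a,b$ and a smooth vector field $U$ on $M$ with $g(U,U)=1$ such that $$\overline{\mathrm{Ric}}(X,Y)=a\,g(X,Y)+b\,g(X,U)\,g(Y,U)\qquad\text{for all tangent vectors }X,Y\text{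 at every point of }M.$$ Suppose also that $U$ is tangent to $F$ (its component along $B$ vanishes everywhere). If $b\neq0$, then $M$ is a simply Riemannian product, that is, $f$ is constant. -/

import Mathlib

open Bundle
open scoped Manifold ContDiff

noncomputable section

namespace WarpedSemiSymm

/-! ### Connections and curvature in a coordinate domain

`G : E → E →L[ℝ] E →L[ℝ] ℝ` is the expression of a Riemannian metric in a chart with values in the
finite-dimensional vector space `E`; vector fields are functions `E → E`. -/

section Coordinates

variable {E : Type*} [NormedAddCommGroup E] [NormedSpace ℝ E]

/-- The Christoffel symbol `Γ_y(u, v)` of the Levi-Civita connection: the vector determined by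
`2 G_y(Γ_y(u, v), w) = (D_u G)(v, w) + (D_v G)(u, w) - (D_w G)(u, v)` for all `w`. Here
`(G y).inverse` is the musical isomorphism from covectors to vectors. -/
def christoffel (G : E → E →L[ℝ] E →L[ℝ] ℝ) (y u v : E) : E :=
  (G y).inverse ((1 / 2 : ℝ) •
    (fderiv ℝ G y u v + fderiv ℝ G y v u - ((fderiv ℝ G y).flip u).flip v))

/-- The Levi-Civita connection `∇_X Y` of the metric `G`. -/
def leviCivita (G : E → E →L[ℝ] E →L[ℝ] ℝ) (X Y : E → E) : E → E :=
  fun y => fderiv ℝ Y y (X y) + christoffel G y (X y) (Y y)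

/-- The semi-symmetric non-metric connection of the metric `G` and the vector field `P`:
`∇̄_X Y = ∇_X Y + π(Y) X` with `π(Y) = G(Y, P)`. -/
def semiSymmConnection (G : E → E →L[ℝ] E →L[ℝ] ℝ) (P : E → E) (X Y : E → E) : E → E :=
  fun y => leviCivita G X Y y + G y (Y y) (P y) • X y

/-- The curvature `R(X, Y) Z = ∇_X ∇_Y Z - ∇_Y ∇_X Z - ∇_[X, Y] Z` of a connection. -/
def curvature (D : (E → E) → (E → E) → E → E) (X Y Z : E → E) : E → E :=
  fun y => D X (D Y Z) y - D Y (D X Z) y - D (VectorField.lieBracket ℝ X Y) Z y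

end Coordinates

/-- The pullback `(u, v) ↦ φ(L u, L v)` of a bilinear form along a linear map. -/
def pullbackForm {V W : Type*} [AddCommGroup V] [Module ℝ V] [TopologicalSpace V]
    [AddCommGroup W] [Module ℝ W] [TopologicalSpace W]
    (φ : W →L[ℝ] W →L[ℝ] ℝ) (L : V →L[ℝ] W) : V →L[ℝ] V →L[ℝ] ℝ :=
  (ContinuousLinearMap.precomp ℝ L).comp (φ.comp L)

/-! ### Objects on a manifold -/

section Manifolds

variable {E : Type*} [NormedAddCommGroup E] [NormedSpace ℝ E]
  {H : Type*} [TopologicalSpace H] (I : ModelWithCorners ℝ E H)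
  {M : Type*} [TopologicalSpace M] [ChartedSpace H M]

/-- The expression of the tensor `g` in the preferred chart around `x₀`. -/
def chartMetric (g : ∀ x : M, TangentSpace I x →L[ℝ] TangentSpace I x →L[ℝ] ℝ) (x₀ : M) :
    E → E →L[ℝ] E →L[ℝ] ℝ :=
  fun y => pullbackForm (g ((extChartAt I x₀).symm y))
    (mfderiv 𝓘(ℝ, E) I (extChartAt I x₀).symm y)

/-- The expression of the vector field `P` in the preferred chart around `x₀`. -/
def chartField (P : ∀ x : M, TangentSpace I x) (x₀ : M) : E → E :=
  fun y => mfderiv I 𝓘(ℝ, E) (extChartAt I x₀) ((extChartAt I x₀).symm y)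
    (P ((extChartAt I x₀).symm y))

/-- The curvature tensor `R̄_x(u, v) w` of the semi-symmetric non-metric connection of `g` and `P`
at a point `x` of a manifold without boundary. It is computed in the chart around `x`, where
`u, v, w` are extended to vector fields with constant components; by tensoriality the extension
and the chart do not matter. -/
def curvatureBar (g : ∀ x : M, TangentSpace I x →L[ℝ] TangentSpace I x →L[ℝ] ℝ)
    (P : ∀ x : M, TangentSpace I x) (x : M) (u v w : TangentSpace I x) : TangentSpace I x :=
  let toE : TangentSpace I x → E := fun t => mfderiv I 𝓘(ℝ, E) (extChartAt I x) x t
  let R : E := curvature (semiSymmConnection (chartMetric I g x) (chartField I P x))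
    (fun _ => toE u) (fun _ => toE v) (fun _ => toE w) (extChartAt I x x)
  (mfderiv I 𝓘(ℝ, E) (extChartAt I x) x).inverse R

/-- `e` is an orthonormal basis of `T_x M` for `g` (the number of vectors is the dimension). -/
def IsOrthonormalFrame (g : ∀ x : M, TangentSpace I x →L[ℝ] TangentSpace I x →L[ℝ] ℝ) (x : M)
    (e : Fin (Module.finrank ℝ E) → TangentSpace I x) : Prop :=
  ∀ i j, g x (e i) (e j) = if i = j then 1 else 0

/-- The Ricci curvature `Ric̄(u, w) = ∑ₖ g(R̄(u, eₖ) w, eₖ)` at `x`, computed with the frame `e`. -/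
def ricciBar (g : ∀ x : M, TangentSpace I x →L[ℝ] TangentSpace I x →L[ℝ] ℝ)
    (P : ∀ x : M, TangentSpace I x) (x : M)
    (e : Fin (Module.finrank ℝ E) → TangentSpace I x) (u w : TangentSpace I x) : ℝ :=
  ∑ k, g x (curvatureBar I g P x u (e k) w) (e k)

/-- `X` is a smooth vector field on `M`. -/
def IsSmoothField [IsManifold I ∞ M] (X : ∀ x : M, TangentSpace I x) : Prop :=
  ContMDiff I I.tangent ∞ (fun x => (⟨x, X x⟩ : TangentBundle I M))

/-- `(M, g)` is quasi-Einstein with respect to the semi-symmetric non-metric connection defined by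
`P`, with scalars `a`, `b` and generator `U`: the smooth vector field `U` is unit, and
`Ric̄(X, Y) = a g(X, Y) + b A(X) A(Y)` with `A(X) = g(X, U)`. Neither non-flatness of `g` nor `P ≠ 0`
is demanded, so that this is the weakest form of the hypothesis. -/
def IsQuasiEinstein [IsManifold I ∞ M]
    (g : ∀ x : M, TangentSpace I x →L[ℝ] TangentSpace I x →L[ℝ] ℝ)
    (P : ∀ x : M, TangentSpace I x) (a b : ℝ) (U : ∀ x : M, TangentSpace I x) : Prop :=
  IsSmoothField I U ∧
  (∀ x, g x (U x) (U x) = 1) ∧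
  ∀ x, ∀ e, IsOrthonormalFrame I g x e → ∀ X Y : TangentSpace I x,
    ricciBar I g P x e X Y = a * g x X Y + b * (g x X (U x) * g x Y (U x))

end Manifolds

/-! ### Warped products -/

section Warped

variable {E₁ : Type*} [NormedAddCommGroup E₁] [NormedSpace ℝ E₁]
  {H₁ : Type*} [TopologicalSpace H₁] (I : ModelWithCorners ℝ E₁ H₁)
  {B : Type*} [TopologicalSpace B] [ChartedSpace H₁ B]
  {E₂ : Type*} [NormedAddCommGroup E₂] [NormedSpace ℝ E₂]
  {H₂ : Type*} [TopologicalSpace H₂] (J : ModelWithCorners ℝ E₂ H₂)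
  {F : Type*} [TopologicalSpace F] [ChartedSpace H₂ F]

/-- The metric `g_B ⊕ f² g_F` of the warped product `B ×_f F`. -/
def warpedMetric (gB : ∀ p : B, TangentSpace I p →L[ℝ] TangentSpace I p →L[ℝ] ℝ)
    (gF : ∀ q : F, TangentSpace J q →L[ℝ] TangentSpace J q →L[ℝ] ℝ) (f : B → ℝ) (x : B × F) :
    TangentSpace (I.prod J) x →L[ℝ] TangentSpace (I.prod J) x →L[ℝ] ℝ :=
  pullbackForm (gB x.1) (mfderiv (I.prod J) I Prod.fst x) +
    (f x.1) ^ 2 • pullbackForm (gF x.2) (mfderiv (I.prod J) J Prod.snd x)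

/-- The vector field `X` on `B × F` is tangent to `B`: it has no component along `F`. -/
def TangentToBase (X : ∀ x : B × F, TangentSpace (I.prod J) x) : Prop :=
  ∀ x, mfderiv (I.prod J) J Prod.snd x (X x) = 0

/-- The vector field `X` on `B × F` is tangent to `F`: it has no component along `B`. -/
def TangentToFibre (X : ∀ x : B × F, TangentSpace (I.prod J) x) : Prop :=
  ∀ x, mfderiv (I.prod J) I Prod.fst x (X x) = 0

/-- The warped product with warping function `f` is a simply Riemannian product: `f` is constant. -/
def IsSimplyRiemannianProduct (f : B → ℝ) : Prop :=
  ∃ c : ℝ, ∀ p, f p = c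

end Warped

end WarpedSemiSymm

end

/-! Since `P` is tangent to the base, `π` vanishes on fibre vectors. Hence, for `v`, `w` tangent to
the fibre at `(p, q)`, both the warping and the semi-symmetric correction change the Ricci trace
only by a multiple of the fibre metric: `Ric̄(v, w) = Ric_F(v, w) + μ g_F(v, w)`, with `μ` depending
on the point but not on `v`, `w` (`exists_ricci_fibre`). As `U` is tangent to the fibre and
`g`-unit, `f U` is `g_F`-unit, and the quasi-Einstein equation becomes `Ric_F = d g_F + b f(p)² A ⊗
A`, where `A` is the `g_F`-dual of `f U` and `d` is a scalar (`exists_fibre_ricci_eq`).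

The left side knows nothing of `p`. Comparing two base points over the same `q` yields two
decompositions of one form on `T_q F` into a multiple of `g_F` and a rank-one part. The rank-one
coefficients have the sign of `b`, and `dim F ≥ 2`, so they agree (`rankOne_coeff_unique`). Thus `b
f(p)² = b f(p')²`, and positivity of `f` gives `f p = f p'`. The comparison is pointwise: no path
between `p` and `p'` is needed.

All curvature computations take place in product charts with constant vector fields. -/

noncomputable section

namespace WarpedSemiSymm

open Filter Topology

set_option maxSynthPendingDepth 3
set_option linter.unusedSectionVars false

/-! ### Christoffel symbols and curvature of constant fields in coordinates -/

section Forms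

variable {E : Type*} [NormedAddCommGroup E] [NormedSpace ℝ E]

/-- A definite bilinear form on a finite-dimensional space is invertible as a map to the dual. -/
theorem isInvertible_of_pos [FiniteDimensional ℝ E] {φ : E →L[ℝ] E →L[ℝ] ℝ}
    (hφ : ∀ v, v ≠ 0 → 0 < φ v v) : φ.IsInvertible := by
  have hinj : Function.Injective φ.toLinearMap := by
    rw [injective_iff_map_eq_zero]
    intro v hv
    by_contra h
    have h1 := hφ v h
    have h2 : φ v = 0 := hv
    simp [h2] at h1
  have hfin : Module.finrank ℝ E = Module.finrank ℝ (E →L[ℝ] ℝ) := by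
    rw [← (LinearMap.toContinuousLinearMap (𝕜 := ℝ) (E := E) (F' := ℝ)).finrank_eq]
    exact (Subspace.dual_finrank_eq (K := ℝ) (V := E)).symm
  exact ⟨(LinearEquiv.ofInjectiveOfFinrankEq φ.toLinearMap hinj hfin).toContinuousLinearEquiv,
    by ext v w; rfl⟩

variable {G : E → E →L[ℝ] E →L[ℝ] ℝ} {y : E}

/-- Koszul's formula as a test: the warped Christoffel symbols below are guessed and checked against
every `w`, without inverting the metric. -/
theorem christoffel_eq_iff (hG : (G y).IsInvertible) (u v z : E) :
    christoffel G y u v = z ↔ ∀ w, 2 * G y z w =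
      fderiv ℝ G y u v w + fderiv ℝ G y v u w - fderiv ℝ G y w u v := by
  unfold christoffel
  rw [hG.inverse_apply_eq, ContinuousLinearMap.ext_iff]
  refine forall_congr' fun w => ?_
  simp only [_root_.smul_apply, _root_.sub_apply,
    _root_.add_apply, ContinuousLinearMap.flip_apply, smul_eq_mul]
  constructor <;> intro h <;> linarith

theorem two_mul_apply_christoffel (hG : (G y).IsInvertible) (u v w : E) :
    2 * G y (christoffel G y u v) w =
      fderiv ℝ G y u v w + fderiv ℝ G y v u w - fderiv ℝ G y w u v :=
  (christoffel_eq_iff hG u v _).1 rfl w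

theorem christoffel_add_right (u v w : E) :
    christoffel G y u (v + w) = christoffel G y u v + christoffel G y u w := by
  unfold christoffel
  rw [← map_add, ← smul_add]
  congr 2
  ext x
  simp
  ring

theorem christoffel_smul_right (c : ℝ) (u v : E) :
    christoffel G y u (c • v) = c • christoffel G y u v := by
  unfold christoffel
  rw [← map_smul, smul_comm c]
  congr 2
  ext x
  simp
  ring

theorem christoffel_zero_left (v : E) : christoffel G y 0 v = 0 := by
  unfold christoffel
  simp

theorem differentiableAt_christoffel [CompleteSpace E] (hG : (G y).IsInvertible)
    (hd : ContDiffAt ℝ 2 G y) (u v : E) :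
    DifferentiableAt ℝ (fun x => christoffel G x u v) y := by
  have h1 : DifferentiableAt ℝ (fun x => (G x).inverse) y :=
    ((hG.contDiffAt_map_inverse (n := 1)).comp y (hd.of_le (by norm_num))).differentiableAt
      (by norm_num)
  have h2 : DifferentiableAt ℝ (fderiv ℝ G) y :=
    (hd.fderiv_right (m := 1) (by norm_num)).differentiableAt (by norm_num)
  unfold christoffel
  refine h1.clm_apply (DifferentiableAt.fun_const_smul ?_ _)
  -- The double flip is composition with two fixed evaluation maps, so differentiability passes from
  -- `fderiv ℝ G` to it.
  have h3 : DifferentiableAt ℝ (fun x => ((fderiv ℝ G x).flip u).flip v) y := by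
    have h4 : ∀ x, ((fderiv ℝ G x).flip u).flip v =
        (ContinuousLinearMap.apply ℝ ℝ v).comp
          ((ContinuousLinearMap.apply ℝ (E →L[ℝ] ℝ) u).comp (fderiv ℝ G x)) := by
      intro x
      ext w
      simp
    simp only [h4]
    exact (differentiableAt_const _).clm_comp ((differentiableAt_const _).clm_comp h2)
  exact ((h2.clm_apply (differentiableAt_const u)).clm_apply (differentiableAt_const v)).fun_add
    ((h2.clm_apply (differentiableAt_const v)).clm_apply (differentiableAt_const u)) |>.fun_sub h3

theorem semiSymmConnection_apply (P X Y : E → E) :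
    semiSymmConnection G P X Y y =
      fderiv ℝ Y y (X y) + christoffel G y (X y) (Y y) + G y (Y y) (P y) • X y := rfl

/-- For constant vector fields the curvature of the semi-symmetric connection has no bracket
term. -/
theorem curvature_semiSymmConnection_const (P : E → E) (u v w : E) :
    curvature (semiSymmConnection G P) (fun _ => u) (fun _ => v) (fun _ => w) y =
      semiSymmConnection G P (fun _ => u)
        (fun x => christoffel G x v w + G x w (P x) • v) y -
      semiSymmConnection G P (fun _ => v)
        (fun x => christoffel G x u w + G x w (P x) • u) y := by
  have hc : ∀ a : E, semiSymmConnection G P (fun _ => a) (fun _ => w) =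
      fun x => christoffel G x a w + G x w (P x) • a := by
    intro a
    funext x
    simp [semiSymmConnection_apply]
  have h0 : semiSymmConnection G P (VectorField.lieBracket ℝ (fun _ => u) fun _ => v)
      (fun _ => w) y = 0 := by
    simp [semiSymmConnection_apply, VectorField.lieBracket, christoffel_zero_left]
  simp only [curvature, hc, h0, sub_zero]

theorem curvature_leviCivita_const (u v w : E) :
    curvature (leviCivita G) (fun _ => u) (fun _ => v) (fun _ => w) y =
      leviCivita G (fun _ => u) (fun x => christoffel G x v w) y -
      leviCivita G (fun _ => v) (fun x => christoffel G x u w) y := by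
  have hc : ∀ a : E, leviCivita G (fun _ => a) (fun _ => w) =
      fun x => christoffel G x a w := by
    intro a
    funext x
    simp [leviCivita]
  have h0 : leviCivita G (VectorField.lieBracket ℝ (fun _ => u) fun _ => v)
      (fun _ => w) y = 0 := by
    simp [leviCivita, VectorField.lieBracket, christoffel_zero_left]
  simp only [curvature, hc, h0, sub_zero]

end Forms

/-! ### Dependence of the curvature on the germ of the metric -/

section Germs

variable {E : Type*} [NormedAddCommGroup E] [NormedSpace ℝ E]

/-- The metric is twice differentiable and positive at the point. -/
structure RegularAt (G : E → E →L[ℝ] E →L[ℝ] ℝ) (y : E) : Prop where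
  contDiffAt : ContDiffAt ℝ 2 G y
  pos : ∀ v, v ≠ 0 → 0 < G y v v

theorem RegularAt.isInvertible [FiniteDimensional ℝ E] {G : E → E →L[ℝ] E →L[ℝ] ℝ} {y : E}
    (h : RegularAt G y) : (G y).IsInvertible :=
  isInvertible_of_pos h.pos

theorem RegularAt.differentiableAt {G : E → E →L[ℝ] E →L[ℝ] ℝ} {y : E}
    (h : RegularAt G y) : DifferentiableAt ℝ G y :=
  h.contDiffAt.differentiableAt (by norm_num)

variable {G G' : E → E →L[ℝ] E →L[ℝ] ℝ} {P P' : E → E} {y : E}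

theorem christoffel_eventuallyEq (h : G =ᶠ[𝓝 y] G') (u v : E) :
    (fun x => christoffel G x u v) =ᶠ[𝓝 y] fun x => christoffel G' x u v := by
  filter_upwards [h.eventuallyEq_nhds] with x hx
  simp only [christoffel, hx.eq_of_nhds, hx.fderiv_eq]

/-- The chart expression of the warped metric is known to have product form only on the chart
target; this transfers the curvature to the product form. -/
theorem curvature_semiSymmConnection_const_congr (h : G =ᶠ[𝓝 y] G') (u v w : E) :
    curvature (semiSymmConnection G P) (fun _ => u) (fun _ => v) (fun _ => w) y =
      curvature (semiSymmConnection G' P) (fun _ => u) (fun _ => v) (fun _ => w) y := by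
  have hY : ∀ v, (fun x => christoffel G x v w + G x w (P x) • v) =ᶠ[𝓝 y]
      fun x => christoffel G' x v w + G' x w (P x) • v := by
    intro v
    filter_upwards [h, christoffel_eventuallyEq h v w] with x h1 h2
    rw [h1, h2]
  have hc : ∀ u v, christoffel G y u v = christoffel G' y u v := fun u v =>
    (christoffel_eventuallyEq h u v).eq_of_nhds
  simp only [curvature_semiSymmConnection_const, semiSymmConnection_apply, (hY _).fderiv_eq,
    hc, h.eq_of_nhds]

theorem christoffel_smul_left (c : ℝ) (u v : E) :
    christoffel G y (c • u) v = c • christoffel G y u v := by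
  unfold christoffel
  rw [← map_smul, smul_comm c]
  congr 2
  ext x
  simp
  ring

theorem curvature_leviCivita_const_smul (c : ℝ) (u v w : E)
    (hv : DifferentiableAt ℝ (fun x => christoffel G x v w) y) :
    curvature (leviCivita G) (fun _ => u) (fun _ => c • v) (fun _ => w) y =
      c • curvature (leviCivita G) (fun _ => u) (fun _ => v) (fun _ => w) y := by
  simp only [curvature_leviCivita_const, leviCivita, christoffel_smul_left,
    christoffel_smul_right, fderiv_fun_const_smul hv, map_smul, _root_.smul_apply]
  module

end Germs

/-! ### Christoffel symbols of a warped product -/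

section Warped

variable {E₁ : Type*} [NormedAddCommGroup E₁] [NormedSpace ℝ E₁]
  {E₂ : Type*} [NormedAddCommGroup E₂] [NormedSpace ℝ E₂]

/-- The warped product metric `GB ⊕ φ² GF` in coordinates. -/
def warpedForm (GB : E₁ → E₁ →L[ℝ] E₁ →L[ℝ] ℝ) (φ : E₁ → ℝ) (GF : E₂ → E₂ →L[ℝ] E₂ →L[ℝ] ℝ)
    (y : E₁ × E₂) : E₁ × E₂ →L[ℝ] E₁ × E₂ →L[ℝ] ℝ :=
  pullbackForm (GB y.1) (ContinuousLinearMap.fst ℝ E₁ E₂) +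
    (φ y.1) ^ 2 • pullbackForm (GF y.2) (ContinuousLinearMap.snd ℝ E₁ E₂)

variable {GB : E₁ → E₁ →L[ℝ] E₁ →L[ℝ] ℝ} {φ : E₁ → ℝ} {GF : E₂ → E₂ →L[ℝ] E₂ →L[ℝ] ℝ}
  {y : E₁ × E₂}

theorem warpedForm_apply (u v : E₁ × E₂) :
    warpedForm GB φ GF y u v = GB y.1 u.1 v.1 + φ y.1 ^ 2 * GF y.2 u.2 v.2 := rfl

theorem fderiv_warpedForm_apply (hB : DifferentiableAt ℝ GB y.1) (hφ : DifferentiableAt ℝ φ y.1)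
    (hF : DifferentiableAt ℝ GF y.2) (a u v : E₁ × E₂) :
    fderiv ℝ (warpedForm GB φ GF) y a u v = fderiv ℝ GB y.1 a.1 u.1 v.1 +
      (2 * φ y.1 * fderiv ℝ φ y.1 a.1 * GF y.2 u.2 v.2 +
        φ y.1 ^ 2 * fderiv ℝ GF y.2 a.2 u.2 v.2) := by
  have hB' : HasFDerivAt (fun x : E₁ × E₂ => GB x.1)
      ((fderiv ℝ GB y.1).comp (ContinuousLinearMap.fst ℝ E₁ E₂)) y :=
    hB.hasFDerivAt.comp y hasFDerivAt_fst
  have hφ' : HasFDerivAt (fun x : E₁ × E₂ => φ x.1)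
      ((fderiv ℝ φ y.1).comp (ContinuousLinearMap.fst ℝ E₁ E₂)) y :=
    hφ.hasFDerivAt.comp y hasFDerivAt_fst
  have hF' : HasFDerivAt (fun x : E₁ × E₂ => GF x.2)
      ((fderiv ℝ GF y.2).comp (ContinuousLinearMap.snd ℝ E₁ E₂)) y :=
    hF.hasFDerivAt.comp y hasFDerivAt_snd
  have hW : DifferentiableAt ℝ (warpedForm GB φ GF) y := by
    unfold warpedForm pullbackForm
    exact ((differentiableAt_const _).clm_comp
        (hB'.differentiableAt.clm_comp (differentiableAt_const _))).fun_add
      ((hφ'.differentiableAt.fun_pow 2).fun_smul ((differentiableAt_const _).clm_comp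
        (hF'.differentiableAt.clm_comp (differentiableAt_const _))))
  -- The scalar function `x ↦ G_x(u, v)` is differentiated twice, through the form and through its
  -- explicit expression; uniqueness of the derivative gives the formula.
  have h1 : HasFDerivAt (fun x => warpedForm GB φ GF x u v)
      (((fderiv ℝ (warpedForm GB φ GF) y).flip u).flip v) y := by
    have := (hW.hasFDerivAt.clm_apply (hasFDerivAt_const u y)).clm_apply (hasFDerivAt_const v y)
    convert! this using 1
    ext a <;> simp
  have h2 := (((hB'.clm_apply (hasFDerivAt_const u.1 y)).clm_apply
    (hasFDerivAt_const v.1 y))).fun_add ((HasFDerivAt.pow hφ' 2).fun_mul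
      ((hF'.clm_apply (hasFDerivAt_const u.2 y)).clm_apply (hasFDerivAt_const v.2 y)))
  have h3 := congrArg (fun L => L a) (h1.unique h2)
  simp at h3
  rw [h3]
  ring

theorem warpedForm_pos (hB : ∀ v, v ≠ 0 → 0 < GB y.1 v v) (hφ : 0 < φ y.1)
    (hF : ∀ v, v ≠ 0 → 0 < GF y.2 v v) (v : E₁ × E₂) (hv : v ≠ 0) :
    0 < warpedForm GB φ GF y v v := by
  have hB' : 0 ≤ GB y.1 v.1 v.1 := by
    rcases eq_or_ne v.1 0 with h | h
    · simp [h]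
    · exact (hB _ h).le
  have hF' : 0 ≤ GF y.2 v.2 v.2 := by
    rcases eq_or_ne v.2 0 with h | h
    · simp [h]
    · exact (hF _ h).le
  rw [warpedForm_apply]
  by_cases h : v.1 = 0
  · have h2 : v.2 ≠ 0 := fun h2 => hv (Prod.ext h h2)
    have := hF _ h2
    positivity
  · have := hB _ h
    positivity

variable [FiniteDimensional ℝ E₁] [FiniteDimensional ℝ E₂]

/-- `φ ∇φ`, where the gradient is taken for the metric `GB`. -/
def warpGradient (GB : E₁ → E₁ →L[ℝ] E₁ →L[ℝ] ℝ) (φ : E₁ → ℝ) (x : E₁) : E₁ :=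
  φ x • (GB x).inverse (fderiv ℝ φ x)

theorem differentiableAt_warpGradient {x : E₁} (hB : RegularAt GB x) (hφ : ContDiffAt ℝ 2 φ x) :
    DifferentiableAt ℝ (warpGradient GB φ) x := by
  have h1 : DifferentiableAt ℝ (fun x => (GB x).inverse) x :=
    ((hB.isInvertible.contDiffAt_map_inverse (n := 1)).comp x
      (hB.contDiffAt.of_le (by norm_num))).differentiableAt (by norm_num)
  have h2 : DifferentiableAt ℝ (fderiv ℝ φ) x :=
    (hφ.fderiv_right (m := 1) (by norm_num)).differentiableAt (by norm_num)
  exact (hφ.differentiableAt (by norm_num)).fun_smul (h1.clm_apply h2)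

/-- The hypotheses on the coordinate expressions of the data of a warped product at a point. -/
structure WarpedRegularAt (GB : E₁ → E₁ →L[ℝ] E₁ →L[ℝ] ℝ) (φ : E₁ → ℝ)
    (GF : E₂ → E₂ →L[ℝ] E₂ →L[ℝ] ℝ) (y : E₁ × E₂) : Prop where
  base : RegularAt GB y.1
  warp : ContDiffAt ℝ 2 φ y.1
  warp_pos : 0 < φ y.1
  fibre : RegularAt GF y.2

namespace WarpedRegularAt

variable (h : WarpedRegularAt GB φ GF y)

include h

theorem isInvertible : (warpedForm GB φ GF y).IsInvertible :=
  isInvertible_of_pos (warpedForm_pos h.base.pos h.warp_pos h.fibre.pos)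

theorem fderiv_apply (a u v : E₁ × E₂) :
    fderiv ℝ (warpedForm GB φ GF) y a u v = fderiv ℝ GB y.1 a.1 u.1 v.1 +
      (2 * φ y.1 * fderiv ℝ φ y.1 a.1 * GF y.2 u.2 v.2 +
        φ y.1 ^ 2 * fderiv ℝ GF y.2 a.2 u.2 v.2) :=
  fderiv_warpedForm_apply h.base.differentiableAt (h.warp.differentiableAt (by norm_num))
    h.fibre.differentiableAt a u v

theorem apply_warpGradient (e : E₁) :
    GB y.1 (warpGradient GB φ y.1) e = φ y.1 * fderiv ℝ φ y.1 e := by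
  simp [warpGradient, h.base.isInvertible.self_apply_inverse]

/-- Against a base vector `e`, Koszul's formula leaves only `-D_e(φ²) GF(v, w)`, which is the source
of `φ ∇φ`; against a fibre vector `φ²` factors out and the symbol of `GF` remains. -/
theorem christoffel_fibre_fibre (v w : E₂) :
    christoffel (warpedForm GB φ GF) y (0, v) (0, w) =
      (-(GF y.2 v w) • warpGradient GB φ y.1, christoffel GF y.2 v w) := by
  rw [christoffel_eq_iff h.isInvertible]
  rintro ⟨e, z⟩
  have := two_mul_apply_christoffel h.fibre.isInvertible v w z
  simp only [h.fderiv_apply, warpedForm_apply, map_smul, _root_.smul_apply, smul_eq_mul,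
    h.apply_warpGradient, map_zero, _root_.zero_apply, mul_zero, zero_add, zero_mul]
  linear_combination (φ y.1) ^ 2 * this

theorem christoffel_fibre_base (v : E₂) (e : E₁) :
    christoffel (warpedForm GB φ GF) y (0, v) (e, 0) =
      (0, (fderiv ℝ φ y.1 e / φ y.1) • v) := by
  rw [christoffel_eq_iff h.isInvertible]
  rintro ⟨e', z⟩
  have := h.warp_pos.ne'
  simp [h.fderiv_apply, warpedForm_apply]
  field_simp

theorem christoffel_base_fibre (e : E₁) (v : E₂) :
    christoffel (warpedForm GB φ GF) y (e, 0) (0, v) =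
      (0, (fderiv ℝ φ y.1 e / φ y.1) • v) := by
  rw [christoffel_eq_iff h.isInvertible]
  rintro ⟨e', z⟩
  have := h.warp_pos.ne'
  simp [h.fderiv_apply, warpedForm_apply]
  field_simp

end WarpedRegularAt

end Warped

/-! ### Curvature and Ricci trace in fibre directions -/

section WarpedCurvature

variable {E₁ : Type*} [NormedAddCommGroup E₁] [NormedSpace ℝ E₁]
  {E₂ : Type*} [NormedAddCommGroup E₂] [NormedSpace ℝ E₂]
  [FiniteDimensional ℝ E₁] [FiniteDimensional ℝ E₂]
  {GB : E₁ → E₁ →L[ℝ] E₁ →L[ℝ] ℝ} {φ : E₁ → ℝ} {GF : E₂ → E₂ →L[ℝ] E₂ →L[ℝ] ℝ}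
  {P : E₁ × E₂ → E₁ × E₂} {y : E₁ × E₂}

theorem WarpedRegularAt.christoffel_fibre_right (h : WarpedRegularAt GB φ GF y) (v : E₂)
    (a : E₁ × E₂) : christoffel (warpedForm GB φ GF) y (0, v) a =
      (-(GF y.2 v a.2) • warpGradient GB φ y.1,
        (fderiv ℝ φ y.1 a.1 / φ y.1) • v + christoffel GF y.2 v a.2) := by
  have ha : a = (a.1, 0) + (0, a.2) := by simp
  conv_lhs => rw [ha]
  rw [christoffel_add_right, h.christoffel_fibre_base, h.christoffel_fibre_fibre]
  simp

theorem WarpedRegularAt.hasFDerivAt_fibre_fibre (h : WarpedRegularAt GB φ GF y) (v w : E₂) :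
    HasFDerivAt (fun x : E₁ × E₂ =>
        ((-(GF x.2 v w) • warpGradient GB φ x.1, christoffel GF x.2 v w) : E₁ × E₂))
      ((-(GF y.2 v w) • (fderiv ℝ (warpGradient GB φ) y.1).comp
            (ContinuousLinearMap.fst ℝ E₁ E₂) +
          (-((((fderiv ℝ GF y.2).flip v).flip w).comp
            (ContinuousLinearMap.snd ℝ E₁ E₂))).smulRight (warpGradient GB φ y.1)).prod
        ((fderiv ℝ (fun x => christoffel GF x v w) y.2).comp
          (ContinuousLinearMap.snd ℝ E₁ E₂))) y := by
  have hS : HasFDerivAt (fun x : E₁ × E₂ => warpGradient GB φ x.1)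
      ((fderiv ℝ (warpGradient GB φ) y.1).comp (ContinuousLinearMap.fst ℝ E₁ E₂)) y :=
    (differentiableAt_warpGradient h.base h.warp).hasFDerivAt.comp y hasFDerivAt_fst
  have hF' : HasFDerivAt (fun x : E₁ × E₂ => GF x.2)
      ((fderiv ℝ GF y.2).comp (ContinuousLinearMap.snd ℝ E₁ E₂)) y :=
    h.fibre.differentiableAt.hasFDerivAt.comp y hasFDerivAt_snd
  have hF : HasFDerivAt (fun x : E₁ × E₂ => GF x.2 v w)
      ((((fderiv ℝ GF y.2).flip v).flip w).comp (ContinuousLinearMap.snd ℝ E₁ E₂)) y := by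
    convert! (hF'.clm_apply (hasFDerivAt_const v y)).clm_apply (hasFDerivAt_const w y) using 1
    ext a <;> simp
  have hΓ : HasFDerivAt (fun x : E₁ × E₂ => christoffel GF x.2 v w)
      ((fderiv ℝ (fun x => christoffel GF x v w) y.2).comp
          (ContinuousLinearMap.snd ℝ E₁ E₂)) y :=
    (differentiableAt_christoffel h.fibre.isInvertible h.fibre.contDiffAt v w).hasFDerivAt.comp y
      hasFDerivAt_snd
  exact (hF.fun_neg.fun_smul hS).prodMk hΓ

/-- The hypotheses on the coordinate expressions hold near a point. -/
theorem eventually_warpedRegularAt (hB : ∀ᶠ x in 𝓝 y.1, RegularAt GB x)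
    (hφ : ∀ᶠ x in 𝓝 y.1, ContDiffAt ℝ 2 φ x) (hφ' : ∀ᶠ x in 𝓝 y.1, 0 < φ x)
    (hF : ∀ᶠ x in 𝓝 y.2, RegularAt GF x) : ∀ᶠ x in 𝓝 y, WarpedRegularAt GB φ GF x := by
  have h1 : Tendsto Prod.fst (𝓝 y) (𝓝 y.1) := continuousAt_fst
  have h2 : Tendsto Prod.snd (𝓝 y) (𝓝 y.2) := continuousAt_snd
  filter_upwards [h1.eventually hB, h1.eventually hφ, h1.eventually hφ', h2.eventually hF] with
    x a b c d using ⟨a, b, c, d⟩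

/-- The scalar by which the base directions contribute to the curvature in fibre directions. -/
def fibreScalar (GB : E₁ → E₁ →L[ℝ] E₁ →L[ℝ] ℝ) (φ : E₁ → ℝ) (GF : E₂ → E₂ →L[ℝ] E₂ →L[ℝ] ℝ)
    (P : E₁ × E₂ → E₁ × E₂) (y : E₁ × E₂) : ℝ :=
  fderiv ℝ φ y.1 (warpGradient GB φ y.1) / φ y.1 +
    warpedForm GB φ GF y (warpGradient GB φ y.1, 0) (P y)

section

variable (h : ∀ᶠ x in 𝓝 y, WarpedRegularAt GB φ GF x)
  (hP : ∀ᶠ x in 𝓝 y, ∀ w, warpedForm GB φ GF x (0, w) (P x) = 0)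

include h hP

/-- The vanishing of `π` on fibre vectors is used in a whole neighbourhood because this field is
differentiated once more in the curvature. -/
theorem fibre_fibre_eventuallyEq (v w : E₂) :
    (fun x => christoffel (warpedForm GB φ GF) x (0, v) (0, w) +
        warpedForm GB φ GF x (0, w) (P x) • (0, v)) =ᶠ[𝓝 y] fun x : E₁ × E₂ =>
      ((-(GF x.2 v w) • warpGradient GB φ x.1, christoffel GF x.2 v w) : E₁ × E₂) := by
  filter_upwards [h, hP] with x hx hx'
  rw [hx', hx.christoffel_fibre_fibre, zero_smul, add_zero]

theorem warpedForm_fibre_fibre_field (v w : E₂) :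
    warpedForm GB φ GF y (-(GF y.2 v w) • warpGradient GB φ y.1, christoffel GF y.2 v w) (P y) =
      -(GF y.2 v w) * warpedForm GB φ GF y (warpGradient GB φ y.1, 0) (P y) := by
  have ha : ((-(GF y.2 v w) • warpGradient GB φ y.1, christoffel GF y.2 v w) : E₁ × E₂) =
      -(GF y.2 v w) • (warpGradient GB φ y.1, 0) + (0, christoffel GF y.2 v w) := by simp
  rw [ha, map_add, _root_.add_apply, hP.self_of_nhds, add_zero, map_smul]
  rfl

/-- The base part `-GF(v, w) φ∇φ` of the first derivative returns to the fibre in two ways: through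
the mixed Christoffel symbol, giving `|∇φ|²`, and through `π`, giving `π(φ∇φ)`. Their sum is
`fibreScalar`. -/
theorem snd_curvature_fibre (u v w : E₂) :
    (curvature (semiSymmConnection (warpedForm GB φ GF) P) (fun _ => (0, u)) (fun _ => (0, v))
      (fun _ => (0, w)) y).2 =
    curvature (leviCivita GF) (fun _ => u) (fun _ => v) (fun _ => w) y.2 -
      fibreScalar GB φ GF P y • (GF y.2 v w • u - GF y.2 u w • v) := by
  have hy := h.self_of_nhds
  have key : ∀ u v : E₂, (semiSymmConnection (warpedForm GB φ GF) P (fun _ => (0, u))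
      (fun x => christoffel (warpedForm GB φ GF) x (0, v) (0, w) +
        warpedForm GB φ GF x (0, w) (P x) • (0, v)) y).2 =
      leviCivita GF (fun _ => u) (fun x => christoffel GF x v w) y.2 -
        (GF y.2 v w * fibreScalar GB φ GF P y) • u := by
    intro u v
    have hY := fibre_fibre_eventuallyEq h hP v w
    rw [semiSymmConnection_apply, hY.fderiv_eq, hY.eq_of_nhds,
      (hy.hasFDerivAt_fibre_fibre v w).fderiv, warpedForm_fibre_fibre_field h hP,
      hy.christoffel_fibre_right]
    simp only [Prod.snd_add, Prod.smul_snd, ContinuousLinearMap.prod_apply,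
      ContinuousLinearMap.comp_apply, ContinuousLinearMap.coe_snd', leviCivita, fibreScalar,
      map_smul, smul_eq_mul]
    module
  rw [curvature_semiSymmConnection_const, curvature_leviCivita_const, Prod.snd_sub, key, key]
  module

/-- Every base component arising here carries the factor `GF(v, w)`, which is constant in the
direction `e`. Only the independence of `T` from `v` and `w` matters afterwards. -/
theorem exists_fst_curvature_fibre (e : E₁) : ∃ T : E₁, ∀ v w : E₂,
    (curvature (semiSymmConnection (warpedForm GB φ GF) P) (fun _ => (0, v)) (fun _ => (e, 0))
      (fun _ => (0, w)) y).1 = GF y.2 v w • T := by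
  have hy := h.self_of_nhds
  set S := warpGradient GB φ y.1 with hS
  -- The first term comes from differentiating along `v`, the others from differentiating along `e`.
  -- The symbol of two base vectors is left unevaluated.
  refine ⟨-(fderiv ℝ φ y.1 e / φ y.1) • S + fderiv ℝ (warpGradient GB φ) y.1 e +
    (christoffel (warpedForm GB φ GF) y (e, 0) (S, 0)).1 +
      warpedForm GB φ GF y (S, 0) (P y) • e, fun v w => ?_⟩
  have hY1 : (fun x => christoffel (warpedForm GB φ GF) x (e, 0) (0, w) +
        warpedForm GB φ GF x (0, w) (P x) • (e, 0)) =ᶠ[𝓝 y] fun x : E₁ × E₂ =>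
      ((0, (fderiv ℝ φ x.1 e / φ x.1) • w) : E₁ × E₂) := by
    filter_upwards [h, hP] with x hx hx'
    rw [hx', hx.christoffel_base_fibre, zero_smul, add_zero]
  have hd : DifferentiableAt ℝ (fun x : E₁ × E₂ => (fderiv ℝ φ x.1 e / φ x.1) • w) y := by
    have h2 : DifferentiableAt ℝ (fderiv ℝ φ) y.1 :=
      (hy.warp.fderiv_right (m := 1) (by norm_num)).differentiableAt (by norm_num)
    have h3 : DifferentiableAt ℝ (fun x => fderiv ℝ φ x e / φ x) y.1 := by
      simp only [div_eq_mul_inv]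
      exact (h2.clm_apply (differentiableAt_const e)).fun_mul
        ((hy.warp.differentiableAt (by norm_num)).fun_inv hy.warp_pos.ne')
    exact (h3.comp y differentiableAt_fst).smul_const w
  have hY2 := fibre_fibre_eventuallyEq h hP v w
  have hs : ((-(GF y.2 v w) • S, christoffel GF y.2 v w) : E₁ × E₂) =
      -(GF y.2 v w) • (S, 0) + (0, christoffel GF y.2 v w) := by simp
  rw [curvature_semiSymmConnection_const, semiSymmConnection_apply, semiSymmConnection_apply,
    hY1.fderiv_eq, hY1.eq_of_nhds, hY2.fderiv_eq, hY2.eq_of_nhds,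
    (hy.hasFDerivAt_fibre_fibre v w).fderiv, warpedForm_fibre_fibre_field h hP,
    hP.self_of_nhds, hy.christoffel_fibre_fibre,
    ((hasFDerivAt_const (0 : E₁) y).prodMk hd.hasFDerivAt).fderiv, ← hS, hs,
    christoffel_add_right, hy.christoffel_base_fibre]
  simp only [Prod.fst_add, Prod.fst_sub, Prod.smul_fst, ContinuousLinearMap.prod_apply,
    ContinuousLinearMap.comp_apply, ContinuousLinearMap.coe_fst', ContinuousLinearMap.coe_snd',
    _root_.add_apply, _root_.smul_apply, _root_.zero_apply, map_smul, smul_eq_mul, map_zero,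
    ContinuousLinearMap.smulRight_apply, _root_.neg_apply, neg_zero,
    christoffel_smul_right]
  module

/-- The trace defining the Ricci curvature, evaluated on fibre vectors: it is the Ricci trace of
the fibre up to a multiple of the fibre metric. -/
theorem exists_ricci_fibre {ι₁ ι₂ : Type*} [Fintype ι₁] [Fintype ι₂] (b : ι₁ → E₁) (c : ι₂ → E₂)
    (hc : ∀ u v, ∑ j, GF y.2 u (c j) * GF y.2 (c j) v = GF y.2 u v)
    (hc' : ∀ j, GF y.2 (c j) (c j) = 1) : ∃ μ : ℝ, ∀ v w : E₂,
    ∑ i, warpedForm GB φ GF y (curvature (semiSymmConnection (warpedForm GB φ GF) P)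
        (fun _ => (0, v)) (fun _ => (b i, 0)) (fun _ => (0, w)) y) (b i, 0) +
      ∑ j, warpedForm GB φ GF y (curvature (semiSymmConnection (warpedForm GB φ GF) P)
        (fun _ => (0, v)) (fun _ => (0, (φ y.1)⁻¹ • c j)) (fun _ => (0, w)) y)
        (0, (φ y.1)⁻¹ • c j) =
      ∑ j, GF y.2 (curvature (leviCivita GF) (fun _ => v) (fun _ => c j) (fun _ => w) y.2) (c j) +
        μ * GF y.2 v w := by
  have hy := h.self_of_nhds
  choose T hT using exists_fst_curvature_fibre h hP
  -- In the fibre sum, `hc` contracts `GF(v, cⱼ) GF(cⱼ, w)` to one copy of `GF(v, w)`, while the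
  -- other term is repeated for each index; hence `1 - card ι₂`.
  refine ⟨∑ i, GB y.1 (T (b i)) (b i) -
    fibreScalar GB φ GF P y * (1 - Fintype.card ι₂), fun v w => ?_⟩
  have h1 : ∀ i, warpedForm GB φ GF y (curvature (semiSymmConnection (warpedForm GB φ GF) P)
        (fun _ => (0, v)) (fun _ => (b i, 0)) (fun _ => (0, w)) y) (b i, 0) =
      GB y.1 (T (b i)) (b i) * GF y.2 v w := by
    intro i
    simp [warpedForm_apply, hT, mul_comm]
  have h2 : ∀ j, warpedForm GB φ GF y (curvature (semiSymmConnection (warpedForm GB φ GF) P)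
        (fun _ => (0, v)) (fun _ => (0, (φ y.1)⁻¹ • c j)) (fun _ => (0, w)) y)
        (0, (φ y.1)⁻¹ • c j) =
      GF y.2 (curvature (leviCivita GF) (fun _ => v) (fun _ => c j) (fun _ => w) y.2) (c j) -
        fibreScalar GB φ GF P y * (GF y.2 v (c j) * GF y.2 (c j) w - GF y.2 v w) := by
    intro j
    -- The two factors `φ⁻¹` of the normalised fibre vector cancel the `φ²` of the warped metric.
    have := hy.warp_pos.ne'
    rw [warpedForm_apply, snd_curvature_fibre h hP, curvature_leviCivita_const_smul _ _ _ _
      (differentiableAt_christoffel hy.fibre.isInvertible hy.fibre.contDiffAt _ _)]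
    simp only [map_zero, map_smul, map_sub, _root_.sub_apply, _root_.smul_apply, smul_eq_mul, hc']
    field_simp
    ring
  simp only [h1, h2, Finset.sum_sub_distrib, ← Finset.mul_sum, ← Finset.sum_mul, hc,
    Finset.sum_const, Finset.card_univ, nsmul_eq_mul]
  ring

end

end WarpedCurvature

/-! ### Orthonormal expansion and uniqueness of rank-one coefficients -/

section PositiveForms

variable {E : Type*} [NormedAddCommGroup E] [NormedSpace ℝ E] [FiniteDimensional ℝ E]
  {φ : E →L[ℝ] E →L[ℝ] ℝ}

/-- A scalar product has an orthonormal basis, in which it is given by Parseval's formula. -/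
theorem exists_orthonormal_expansion (hs : ∀ v w, φ v w = φ w v) (hp : ∀ v, v ≠ 0 → 0 < φ v v) :
    ∃ c : Fin (Module.finrank ℝ E) → E, (∀ i j, φ (c i) (c j) = if i = j then 1 else 0) ∧
      ∀ u v, ∑ j, φ u (c j) * φ (c j) v = φ u v := by
  let ψ : LinearMap.BilinForm ℝ E := LinearMap.mk₂ ℝ (fun v w => φ v w)
    (by simp) (by simp) (by simp) (by simp)
  have hψ : LinearMap.IsSymm ψ := ⟨fun v w => hs v w⟩
  obtain ⟨b, hb⟩ := LinearMap.BilinForm.exists_orthogonal_basis hψ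
  have hpos : ∀ i, 0 < φ (b i) (b i) := fun i => hp _ (b.ne_zero i)
  have hort : ∀ i j, i ≠ j → φ (b i) (b j) = 0 := fun i j hij => hb hij
  set c : Fin (Module.finrank ℝ E) → E := fun i => (√(φ (b i) (b i)))⁻¹ • b i with hc
  have hcc : ∀ i j, φ (c i) (c j) = if i = j then 1 else 0 := by
    intro i j
    have := hpos i
    split_ifs with hij
    · subst hij
      have h2 := Real.mul_self_sqrt this.le
      have h3 := (Real.sqrt_pos.2 this).ne'
      simp only [hc, map_smul, _root_.smul_apply, smul_eq_mul]
      field_simp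
      linarith
    · simp [hc, hort i j hij]
  refine ⟨c, hcc, fun u v => ?_⟩
  have hspan : ∀ v, ∃ a : Fin (Module.finrank ℝ E) → ℝ, v = ∑ i, a i • c i := by
    intro v
    refine ⟨fun i => b.repr v i * √(φ (b i) (b i)), ?_⟩
    conv_lhs => rw [← b.sum_repr v]
    refine Finset.sum_congr rfl fun i _ => ?_
    have h3 := (Real.sqrt_pos.2 (hpos i)).ne'
    rw [hc, smul_smul, mul_assoc, mul_inv_cancel₀ h3, mul_one]
  obtain ⟨a, rfl⟩ := hspan v
  simp [hcc]
  exact Finset.sum_congr rfl fun j _ => mul_comm _ _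

/-- If a scalar product plus a rank-one form has two such decompositions with the rank-one parts
of the same sign, then the rank-one parts have the same size. -/
theorem rankOne_coeff_unique (hE : 2 ≤ Module.finrank ℝ E) (hs : ∀ v w, φ v w = φ w v)
    (hp : ∀ v, v ≠ 0 → 0 < φ v v) {d β β' : ℝ} {u u' : E} (hu : φ u u = 1) (hu' : φ u' u' = 1)
    (hβ : 0 < β * β')
    (h : ∀ v w, β * (φ v u * φ w u) = β' * (φ v u' * φ w u') + d * φ v w) : β = β' := by
  set t := φ u u' with ht
  have ht' : φ u' u = t := hs _ _
  have h1 := h u u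
  have h2 := h u' u'
  simp only [hu, hu', ht', ← ht, mul_one] at h1 h2
  -- Subtracting the evaluations at `(u, u)` and `(u', u')` eliminates `d`.
  have hsum : (β + β') * (1 - t * t) = 0 := by linarith
  -- Equality of signs is essential: in dimension two, orthogonal `u`, `u'` with `β' = -β` and `d =
  -- β` satisfy the identity.
  have hne : β + β' ≠ 0 := by
    intro h0
    have : β' = -β := by linarith
    rw [this] at hβ
    nlinarith [sq_nonneg β]
  have htt : t * t = 1 := by
    rcases mul_eq_zero.1 hsum with h0 | h0
    · exact absurd h0 hne
    · linarith
  -- The equality case of Cauchy–Schwarz: this vector has square norm `1 - t² = 0`.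
  have hu2 : u' - t • u = 0 := by
    by_contra h0
    have := hp _ h0
    simp only [map_sub, map_smul, _root_.sub_apply, _root_.smul_apply, smul_eq_mul, hu, hu', ht',
      ← ht] at this
    nlinarith
  -- Dimension at least two supplies a vector orthogonal to `u`, hence to `u' = t u`; evaluating
  -- there isolates `d`.
  have hker : ∃ v, v ≠ 0 ∧ φ u v = 0 := by
    have hlt : Module.finrank ℝ ℝ < Module.finrank ℝ E := by
      rw [Module.finrank_self]
      omega
    have hbot := LinearMap.ker_ne_bot_of_finrank_lt (f := (φ u).toLinearMap) hlt
    obtain ⟨v, hv, hv0⟩ := Submodule.exists_mem_ne_zero_of_ne_bot hbot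
    exact ⟨v, hv0, hv⟩
  obtain ⟨v, hv0, hv⟩ := hker
  have h3 := h v v
  have hvu : φ v u = 0 := by rw [hs, hv]
  have hvu' : φ v u' = 0 := by
    rw [sub_eq_zero.1 hu2, map_smul, hvu, smul_zero]
  have hd : d = 0 := by
    have := hp v hv0
    rw [hvu, hvu'] at h3
    have h4 : d * φ v v = 0 := by linarith
    exact (mul_eq_zero.1 h4).resolve_right this.ne'
  rw [htt, hd] at h1
  linarith

end PositiveForms

/-! ### Metric and Ricci trace read in a chart -/

section Charts

variable {E : Type*} [NormedAddCommGroup E] [NormedSpace ℝ E]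
  {H : Type*} [TopologicalSpace H] {I : ModelWithCorners ℝ E H} [I.Boundaryless]
  {M : Type*} [TopologicalSpace M] [ChartedSpace H M] [IsManifold I ∞ M]

theorem mfderiv_extChartAt_symm_self (x : M) :
    mfderiv 𝓘(ℝ, E) I (extChartAt I x).symm (extChartAt I x x) =
      ContinuousLinearMap.id ℝ E := by
  have : IsManifold I 1 M := .of_le (n := ∞) (by norm_num)
  have h := mfderivWithin_range_extChartAt_symm (I := I) (x := x)
  rwa [I.range_eq_univ, mfderivWithin_univ] at h

theorem isInvertible_mfderiv_extChartAt_symm {x : M} {y : E} (hy : y ∈ (extChartAt I x).target) :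
    (mfderiv 𝓘(ℝ, E) I (extChartAt I x).symm y).IsInvertible := by
  have : IsManifold I 1 M := .of_le (n := ∞) (by norm_num)
  have h := isInvertible_mfderivWithin_extChartAt_symm hy
  rwa [I.range_eq_univ, mfderivWithin_univ] at h

theorem mdifferentiableAt_extChartAt_symm {x : M} {y : E} (hy : y ∈ (extChartAt I x).target) :
    MDifferentiableAt 𝓘(ℝ, E) I (extChartAt I x).symm y := by
  have : IsManifold I 1 M := .of_le (n := ∞) (by norm_num)
  have h := mdifferentiableWithinAt_extChartAt_symm hy
  rwa [I.range_eq_univ, mdifferentiableWithinAt_univ] at h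

theorem chartMetric_apply (g : ∀ x : M, TangentSpace I x →L[ℝ] TangentSpace I x →L[ℝ] ℝ) (x : M)
    (y u v : E) : chartMetric I g x y u v = g ((extChartAt I x).symm y)
      (mfderiv 𝓘(ℝ, E) I (extChartAt I x).symm y u)
      (mfderiv 𝓘(ℝ, E) I (extChartAt I x).symm y v) := rfl

theorem chartMetric_self (g : ∀ x : M, TangentSpace I x →L[ℝ] TangentSpace I x →L[ℝ] ℝ) (x : M)
    (u v : E) : chartMetric I g x (extChartAt I x x) u v = (g x : E →L[ℝ] E →L[ℝ] ℝ) u v := by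
  rw [chartMetric_apply, mfderiv_extChartAt_symm_self, extChartAt_to_inv]
  rfl

/-- At its centre the preferred chart has identity derivative, so tangent vectors serve as their own
coordinates. -/
theorem ricciBar_eq (g : ∀ x : M, TangentSpace I x →L[ℝ] TangentSpace I x →L[ℝ] ℝ)
    (P : ∀ x : M, TangentSpace I x) (x : M)
    (e : Fin (Module.finrank ℝ E) → TangentSpace I x) (u w : TangentSpace I x) :
    ricciBar I g P x e u w = ∑ k, chartMetric I g x (extChartAt I x x)
      (curvature (semiSymmConnection (chartMetric I g x) (chartField I P x))
        (fun _ => (u : E)) (fun _ => (e k : E)) (fun _ => (w : E)) (extChartAt I x x))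
      (e k : E) := by
  have : IsManifold I 1 M := .of_le (n := ∞) (by norm_num)
  unfold ricciBar curvatureBar
  simp only [mfderiv_extChartAt_self]
  refine Finset.sum_congr rfl fun k _ => ?_
  have : (ContinuousLinearMap.id ℝ E).inverse = ContinuousLinearMap.id ℝ E :=
    ContinuousLinearMap.inverse_id
  erw [this]
  exact (chartMetric_self g x _ _).symm

variable (g : ContMDiffRiemannianMetric I ∞ E (fun x : M => TangentSpace I x))

theorem chartMetric_pos {x : M} {y : E} (hy : y ∈ (extChartAt I x).target) (v : E) (hv : v ≠ 0) :
    0 < chartMetric I g.inner x y v v := by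
  rw [chartMetric_apply]
  refine g.pos _ _ fun h => hv ?_
  exact (isInvertible_mfderiv_extChartAt_symm hy).injective (h.trans (map_zero _).symm)

theorem chartMetric_symm (x : M) (y u v : E) :
    chartMetric I g.inner x y u v = chartMetric I g.inner x y v u := by
  rw [chartMetric_apply, chartMetric_apply, g.symm]

/-- Smoothness of `g` as a bundle section is smoothness in the trivialization at `x`, whose inverse
on fibres is the derivative of the inverse chart; this is the map through which `chartMetric` pulls
back. -/
theorem contDiffAt_chartMetric (x : M) :
    ContDiffAt ℝ ∞ (chartMetric I g.inner x) (extChartAt I x x) := by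
  have : IsManifold I 1 M := .of_le (n := ∞) (by norm_num)
  have h1 : ContMDiffAt I 𝓘(ℝ, E →L[ℝ] E →L[ℝ] ℝ) ∞ (fun b =>
      (trivializationAt (E →L[ℝ] E →L[ℝ] ℝ)
        (fun x : M => TangentSpace I x →L[ℝ] TangentSpace I x →L[ℝ] ℝ) x ⟨b, g.inner b⟩).2) x :=
    (contMDiffAt_section x).1 (g.contMDiff x)
  have h2 : ContMDiffAt 𝓘(ℝ, E) I ∞ (extChartAt I x).symm (extChartAt I x x) :=
    (contMDiffOn_extChartAt_symm x).contMDiffAt (extChartAt_target_mem_nhds x)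
  rw [← extChartAt_to_inv (I := I) x] at h1
  have h3 := (h1.comp _ h2).contDiffAt
  rw [extChartAt_to_inv] at h3
  refine h3.congr_of_eventuallyEq ?_
  filter_upwards [extChartAt_target_mem_nhds (I := I) x] with y hy
  have hy' : (extChartAt I x).symm y ∈ (chartAt H x).source := by
    simpa using (extChartAt I x).map_target hy
  have hsymm := TangentBundle.symmL_trivializationAt (I := I) hy'
  rw [(extChartAt I x).right_inv hy, I.range_eq_univ, mfderivWithin_univ] at hsymm
  ext u v
  simp only [Function.comp_apply, hom_trivializationAt_apply]
  rw [inCoordinates_apply_eq₂ (by simpa using hy') (by simpa using hy')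
    (Set.mem_univ _), chartMetric_apply]
  have hb : (extChartAt I x).symm y ∈ (trivializationAt E (TangentSpace I) x).baseSet := by
    simpa using hy'
  have hs : ∀ u : E, (trivializationAt E (TangentSpace I) x).symm ((extChartAt I x).symm y) u =
      mfderiv 𝓘(ℝ, E) I (extChartAt I x).symm y u := fun u =>
    (Trivialization.symmL_apply (R := ℝ) _ hb u).symm.trans (DFunLike.congr_fun hsymm u)
  rw [hs, hs]
  simp

end Charts

/-! ### The warped metric in a product chart -/

section WarpedCharts

variable {E₁ : Type*} [NormedAddCommGroup E₁] [NormedSpace ℝ E₁]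
  {H₁ : Type*} [TopologicalSpace H₁] {I : ModelWithCorners ℝ E₁ H₁} [I.Boundaryless]
  {B : Type*} [TopologicalSpace B] [ChartedSpace H₁ B] [IsManifold I ∞ B]
  {E₂ : Type*} [NormedAddCommGroup E₂] [NormedSpace ℝ E₂]
  {H₂ : Type*} [TopologicalSpace H₂] {J : ModelWithCorners ℝ E₂ H₂} [J.Boundaryless]
  {F : Type*} [TopologicalSpace F] [ChartedSpace H₂ F] [IsManifold J ∞ F]

theorem mem_extChartAt_prod_target {x : B × F} {y : E₁ × E₂} :
    y ∈ (extChartAt (I.prod J) x).target ↔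
      y.1 ∈ (extChartAt I x.1).target ∧ y.2 ∈ (extChartAt J x.2).target := by
  rw [extChartAt_prod]
  rfl

theorem fst_mfderiv_extChartAt_symm {x : B × F} {y : E₁ × E₂}
    (hy : y ∈ (extChartAt (I.prod J) x).target) (u : E₁ × E₂) :
    mfderiv (I.prod J) I Prod.fst ((extChartAt (I.prod J) x).symm y)
        (mfderiv 𝓘(ℝ, E₁ × E₂) (I.prod J) (extChartAt (I.prod J) x).symm y u) =
      mfderiv 𝓘(ℝ, E₁) I (extChartAt I x.1).symm y.1 u.1 := by
  have hy' := mem_extChartAt_prod_target.1 hy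
  have h1 := (hasMFDerivAt_fst (I := I) (I' := J) ((extChartAt (I.prod J) x).symm y)).comp y
    (mdifferentiableAt_extChartAt_symm hy).hasMFDerivAt
  have h2 := (mdifferentiableAt_extChartAt_symm hy'.1).hasMFDerivAt.comp y
    (ContinuousLinearMap.fst ℝ E₁ E₂).hasMFDerivAt
  have h3 : (Prod.fst ∘ (extChartAt (I.prod J) x).symm) =
      (extChartAt I x.1).symm ∘ (ContinuousLinearMap.fst ℝ E₁ E₂) := by
    rw [extChartAt_prod]
    rfl
  rw [h3] at h1
  rw [mfderiv_fst]
  exact congrArg (fun L => L u) (hasMFDerivAt_unique h1 h2)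

theorem snd_mfderiv_extChartAt_symm {x : B × F} {y : E₁ × E₂}
    (hy : y ∈ (extChartAt (I.prod J) x).target) (u : E₁ × E₂) :
    mfderiv (I.prod J) J Prod.snd ((extChartAt (I.prod J) x).symm y)
        (mfderiv 𝓘(ℝ, E₁ × E₂) (I.prod J) (extChartAt (I.prod J) x).symm y u) =
      mfderiv 𝓘(ℝ, E₂) J (extChartAt J x.2).symm y.2 u.2 := by
  have hy' := mem_extChartAt_prod_target.1 hy
  have h1 := (hasMFDerivAt_snd (I := I) (I' := J) ((extChartAt (I.prod J) x).symm y)).comp y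
    (mdifferentiableAt_extChartAt_symm hy).hasMFDerivAt
  have h2 := (mdifferentiableAt_extChartAt_symm hy'.2).hasMFDerivAt.comp y
    (ContinuousLinearMap.snd ℝ E₁ E₂).hasMFDerivAt
  have h3 : (Prod.snd ∘ (extChartAt (I.prod J) x).symm) =
      (extChartAt J x.2).symm ∘ (ContinuousLinearMap.snd ℝ E₁ E₂) := by
    rw [extChartAt_prod]
    rfl
  rw [h3] at h1
  rw [mfderiv_snd]
  exact congrArg (fun L => L u) (hasMFDerivAt_unique h1 h2)

variable (gB : ∀ p : B, TangentSpace I p →L[ℝ] TangentSpace I p →L[ℝ] ℝ)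
  (gF : ∀ q : F, TangentSpace J q →L[ℝ] TangentSpace J q →L[ℝ] ℝ) (f : B → ℝ)

theorem chartMetric_warpedMetric (x : B × F) {y : E₁ × E₂}
    (hy : y ∈ (extChartAt (I.prod J) x).target) :
    chartMetric (I.prod J) (warpedMetric I J gB gF f) x y =
      warpedForm (chartMetric I gB x.1) (fun z => f ((extChartAt I x.1).symm z))
        (chartMetric J gF x.2) y := by
  have h3 : ((extChartAt (I.prod J) x).symm y) =
      ((extChartAt I x.1).symm y.1, (extChartAt J x.2).symm y.2) := by
    rw [extChartAt_prod]
    rfl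
  refine ContinuousLinearMap.ext fun u => ContinuousLinearMap.ext fun v => ?_
  rw [warpedForm_apply, chartMetric_apply, chartMetric_apply, chartMetric_apply]
  have h1 := fst_mfderiv_extChartAt_symm hy
  have h2 := snd_mfderiv_extChartAt_symm hy
  change gB _ (mfderiv (I.prod J) I Prod.fst _ _) (mfderiv (I.prod J) I Prod.fst _ _) +
    f _ ^ 2 * gF _ (mfderiv (I.prod J) J Prod.snd _ _) (mfderiv (I.prod J) J Prod.snd _ _) = _
  rw [h1, h1, h2, h2, h3]

theorem warpedMetric_fibre_chartField {P : ∀ x : B × F, TangentSpace (I.prod J) x}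
    (hP : TangentToBase I J P) (x : B × F) {y : E₁ × E₂}
    (hy : y ∈ (extChartAt (I.prod J) x).target) (w : E₂) :
    chartMetric (I.prod J) (warpedMetric I J gB gF f) x y (0, w)
      (chartField (I.prod J) P x y) = 0 := by
  have : IsManifold (I.prod J) 1 (B × F) := .of_le (n := ∞) (by norm_num)
  set c : E₁ × E₂ := chartField (I.prod J) P x y with hc
  -- The derivatives of the chart and of its inverse cancel, so the pairing is with `P` itself,
  -- which has no fibre component.
  have h0 : mfderiv 𝓘(ℝ, E₁ × E₂) (I.prod J) (extChartAt (I.prod J) x).symm y c = P ((extChartAt (I.prod J) x).symm y) := by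
    have h := mfderivWithin_extChartAt_symm_comp_mfderiv_extChartAt hy
    rw [(I.prod J).range_eq_univ, mfderivWithin_univ] at h
    exact DFunLike.congr_fun h (P _)
  have h1 := fst_mfderiv_extChartAt_symm hy (0, w)
  rw [chartMetric_apply, h0]
  change gB _ (mfderiv (I.prod J) I Prod.fst _ _) _ +
    f _ ^ 2 * gF _ _ (mfderiv (I.prod J) J Prod.snd _ _) = _
  have h1' : mfderiv 𝓘(ℝ, E₁) I (extChartAt I x.1).symm y.1 (0 : E₁) = 0 :=
    (mfderiv 𝓘(ℝ, E₁) I (extChartAt I x.1).symm y.1).map_zero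
  rw [h1, hP, (gF _ _).map_zero, mul_zero, add_zero]
  erw [h1', (gB _).map_zero]
  rfl

end WarpedCharts

/-! ### Regularity of the chart expressions near the centre -/

section RegularCharts

variable {E : Type*} [NormedAddCommGroup E] [NormedSpace ℝ E]
  {H : Type*} [TopologicalSpace H] {I : ModelWithCorners ℝ E H} [I.Boundaryless]
  {M : Type*} [TopologicalSpace M] [ChartedSpace H M] [IsManifold I ∞ M]

theorem eventually_regularAt_chartMetric
    (g : ContMDiffRiemannianMetric I ∞ E (fun x : M => TangentSpace I x)) (x : M) :
    ∀ᶠ y in 𝓝 (extChartAt I x x), RegularAt (chartMetric I g.inner x) y := by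
  have h := ((contDiffAt_chartMetric g x).of_le (m := 2)
    (show ((2 : ℕ∞) : ℕ∞ω) ≤ ∞ from WithTop.coe_le_coe.2 le_top)).eventually
    (by simp)
  filter_upwards [h, extChartAt_target_mem_nhds (I := I) x] with y hy hy'
  exact ⟨hy, chartMetric_pos g hy'⟩

theorem eventually_contDiffAt_chart {f : M → ℝ} (hf : ContMDiff I 𝓘(ℝ, ℝ) ∞ f) (x : M) :
    ∀ᶠ y in 𝓝 (extChartAt I x x), ContDiffAt ℝ 2 (fun z => f ((extChartAt I x).symm z)) y := by
  have h2 : ContMDiffAt 𝓘(ℝ, E) I ∞ (extChartAt I x).symm (extChartAt I x x) :=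
    (contMDiffOn_extChartAt_symm x).contMDiffAt (extChartAt_target_mem_nhds x)
  have h3 : ContDiffAt ℝ ∞ (f ∘ (extChartAt I x).symm) (extChartAt I x x) :=
    (hf.contMDiffAt.comp _ h2).contDiffAt
  exact (h3.of_le (m := 2)
    (show ((2 : ℕ∞) : ℕ∞ω) ≤ ∞ from WithTop.coe_le_coe.2 le_top)).eventually (by simp)

end RegularCharts

/-! ### The fibre Ricci identity and constancy of the warping function -/

section Fibre

variable {E₁ : Type*} [NormedAddCommGroup E₁] [NormedSpace ℝ E₁] [FiniteDimensional ℝ E₁]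
  {H₁ : Type*} [TopologicalSpace H₁] {I : ModelWithCorners ℝ E₁ H₁} [I.Boundaryless]
  {B : Type*} [TopologicalSpace B] [ChartedSpace H₁ B] [IsManifold I ∞ B]
  {E₂ : Type*} [NormedAddCommGroup E₂] [NormedSpace ℝ E₂] [FiniteDimensional ℝ E₂]
  {H₂ : Type*} [TopologicalSpace H₂] {J : ModelWithCorners ℝ E₂ H₂} [J.Boundaryless]
  {F : Type*} [TopologicalSpace F] [ChartedSpace H₂ F] [IsManifold J ∞ F]
  {gB : ContMDiffRiemannianMetric I ∞ E₁ (fun p : B => TangentSpace I p)}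
  {gF : ContMDiffRiemannianMetric J ∞ E₂ (fun q : F => TangentSpace J q)}
  {f : B → ℝ}

/-- On a warped product which is quasi-Einstein with generator tangent to the fibres, the Ricci
trace of the fibre is a multiple of the fibre metric plus a rank-one form of size `b f²`. -/
theorem exists_fibre_ricci_eq (hf : ContMDiff I 𝓘(ℝ, ℝ) ∞ f) (hfpos : ∀ p, 0 < f p)
    {P U : ∀ x : B × F, TangentSpace (I.prod J) x} (hPB : TangentToBase I J P)
    (hUF : TangentToFibre I J U) {a b : ℝ}
    (hM : IsQuasiEinstein (I.prod J) (warpedMetric I J gB.inner gF.inner f) P a b U)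
    (p : B) (q : F) {ι : Type*} [Fintype ι] [DecidableEq ι] (hι : Fintype.card ι = Module.finrank ℝ E₂)
    (c : ι → E₂)
    (hc : ∀ i j, chartMetric J gF.inner q (extChartAt J q q) (c i) (c j) =
      if i = j then 1 else 0)
    (hc' : ∀ u v, ∑ j, chartMetric J gF.inner q (extChartAt J q q) u (c j) *
      chartMetric J gF.inner q (extChartAt J q q) (c j) v =
        chartMetric J gF.inner q (extChartAt J q q) u v) :
    ∃ (d : ℝ) (u : E₂), chartMetric J gF.inner q (extChartAt J q q) u u = 1 ∧ ∀ v w,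
      ∑ j, chartMetric J gF.inner q (extChartAt J q q)
        (curvature (leviCivita (chartMetric J gF.inner q)) (fun _ => v) (fun _ => c j)
          (fun _ => w) (extChartAt J q q)) (c j) =
      d * chartMetric J gF.inner q (extChartAt J q q) v w + b * f p ^ 2 *
        (chartMetric J gF.inner q (extChartAt J q q) v u *
          chartMetric J gF.inner q (extChartAt J q q) w u) := by
  obtain ⟨-, hU, hE⟩ := hM
  set x : B × F := (p, q) with hx
  set y : E₁ × E₂ := extChartAt (I.prod J) x x with hy
  set GF := chartMetric J gF.inner q with hGF
  set GB := chartMetric I gB.inner p with hGB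
  set φ : E₁ → ℝ := fun z => f ((extChartAt I p).symm z) with hφ
  set G := chartMetric (I.prod J) (warpedMetric I J gB.inner gF.inner f) x with hG
  have hy1 : y.1 = extChartAt I p p := by
    rw [hy, extChartAt_prod]
    rfl
  have hy2 : y.2 = extChartAt J q q := by
    rw [hy, extChartAt_prod]
    rfl
  have hφy : φ y.1 = f p := by
    rw [hφ, hy1]
    simp only [extChartAt_to_inv]
  have hGW : G =ᶠ[𝓝 y] warpedForm GB φ GF := by
    filter_upwards [extChartAt_target_mem_nhds (I := I.prod J) x] with z hz
    exact chartMetric_warpedMetric gB.inner gF.inner f x hz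
  have hreg : ∀ᶠ z in 𝓝 y, WarpedRegularAt GB φ GF z := by
    apply eventually_warpedRegularAt
    · rw [hy1]
      exact eventually_regularAt_chartMetric gB p
    · rw [hy1]
      exact eventually_contDiffAt_chart hf p
    · exact Eventually.of_forall fun z => hfpos _
    · rw [hy2]
      exact eventually_regularAt_chartMetric gF q
  set P' : E₁ × E₂ → E₁ × E₂ := chartField (I.prod J) P x with hP'
  have hP : ∀ᶠ z in 𝓝 y, ∀ w, warpedForm GB φ GF z (0, w) (P' z) = 0 := by
    filter_upwards [hGW, extChartAt_target_mem_nhds (I := I.prod J) x] with z hz hz' w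
    rw [← hz]
    exact warpedMetric_fibre_chartField gB.inner gF.inner f hPB x hz' w
  have hmet : ∀ u v : E₁ × E₂,
      (warpedMetric I J gB.inner gF.inner f x : E₁ × E₂ →L[ℝ] E₁ × E₂ →L[ℝ] ℝ) u v =
        GB y.1 u.1 v.1 + f p ^ 2 * GF y.2 u.2 v.2 := by
    intro u v
    rw [← chartMetric_self (I := I.prod J) (warpedMetric I J gB.inner gF.inner f) x u v, ← hy,
      ← hG, hGW.eq_of_nhds, warpedForm_apply, hφy]
  rw [← hy2] at hc hc' ⊢
  obtain ⟨e, he, -⟩ := exists_orthonormal_expansion (φ := GB y.1)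
    (fun v w => chartMetric_symm gB p _ v w) hreg.self_of_nhds.base.pos
  have hfp := hfpos p
  -- The fibre frame `c` is orthonormal for `g_F`, independently of `p`; dividing by `φ` makes it
  -- orthonormal for the warped metric.
  let ε' : Fin (Module.finrank ℝ E₁) ⊕ ι → E₁ × E₂ :=
    Sum.elim (fun i => (e i, 0)) (fun j => (0, (φ y.1)⁻¹ • c j))
  have hcard : Fintype.card (Fin (Module.finrank ℝ E₁) ⊕ ι) =
      Fintype.card (Fin (Module.finrank ℝ (E₁ × E₂))) := by
    simp [hι]
  let σ := Fintype.equivOfCardEq hcard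
  let ε : Fin (Module.finrank ℝ (E₁ × E₂)) → E₁ × E₂ := ε' ∘ σ.symm
  have horth' : ∀ i j, GB y.1 (ε' i).1 (ε' j).1 + f p ^ 2 * GF y.2 (ε' i).2 (ε' j).2 =
      if i = j then 1 else 0 := by
    rintro (i | i) (j | j)
    · simp [ε', he]
    · simp [ε']
    · simp [ε']
    · simp only [ε', Sum.elim_inr, map_zero, map_smul, _root_.smul_apply,
        smul_eq_mul, hc, hφy, Sum.inr.injEq]
      split_ifs
      · field_simp
        ring
      · ring
  have horth : IsOrthonormalFrame (I.prod J) (warpedMetric I J gB.inner gF.inner f) x ε := by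
    intro i j
    refine (hmet (ε i) (ε j)).trans ?_
    simp only [ε, Function.comp_apply, horth', EmbeddingLike.apply_eq_iff_eq]
  obtain ⟨μ, hμ⟩ := exists_ricci_fibre hreg hP e c hc' (fun j => by simp [hc])
  let u : E₁ × E₂ := U x
  have hu1 : u.1 = 0 := by
    have := hUF x
    rw [mfderiv_fst] at this
    exact this
  have huu : f p ^ 2 * GF y.2 u.2 u.2 = 1 := by
    have := (hmet u u).symm.trans (hU x)
    rwa [hu1, map_zero, zero_add] at this
  -- The term in `b` has the factor `f⁴`; two powers are absorbed in normalising `u.2` to a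
  -- `g_F`-unit vector, leaving `b f²`.
  refine ⟨a * f p ^ 2 - μ, f p • u.2, ?_, fun v w => ?_⟩
  · simp only [map_smul, _root_.smul_apply, smul_eq_mul]
    linarith
  have key := hE x ε horth ((0, v) : E₁ × E₂) ((0, w) : E₁ × E₂)
  have hsum : ∑ k, G y (curvature (semiSymmConnection G P') (fun _ => (0, v)) (fun _ => ε k)
      (fun _ => (0, w)) y) (ε k) =
      a * (f p ^ 2 * GF y.2 v w) + b * (f p ^ 2 * GF y.2 v u.2 * (f p ^ 2 * GF y.2 w u.2)) := by
    refine (ricciBar_eq (I := I.prod J) _ P x ε _ _).symm.trans (key.trans ?_)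
    have h1 := hmet (0, v) (0, w)
    have h2 := hmet (0, v) u
    have h3 := hmet (0, w) u
    simp only [map_zero, _root_.zero_apply, zero_add] at h1 h2 h3
    rw [← h1, ← h2, ← h3]
  have hsum' : ∑ k, G y (curvature (semiSymmConnection G P') (fun _ => (0, v)) (fun _ => ε k)
      (fun _ => (0, w)) y) (ε k) = ∑ k, warpedForm GB φ GF y
        (curvature (semiSymmConnection (warpedForm GB φ GF) P') (fun _ => (0, v))
          (fun _ => ε' k) (fun _ => (0, w)) y) (ε' k) := by
    rw [← Equiv.sum_comp σ.symm]
    refine Finset.sum_congr rfl fun k _ => ?_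
    rw [curvature_semiSymmConnection_const_congr hGW, hGW.eq_of_nhds]
    rfl
  rw [hsum', Fintype.sum_sum_type] at hsum
  have h4 := (hμ v w).symm.trans hsum
  simp only [map_smul, smul_eq_mul]
  linear_combination h4

/-- The warping function of a warped product which is quasi-Einstein with `b ≠ 0` and generator
tangent to the fibres takes the same value at any two points of the base. -/
theorem warp_constant (hn : 2 ≤ Module.finrank ℝ E₂) [Nonempty F]
    (hf : ContMDiff I 𝓘(ℝ, ℝ) ∞ f) (hfpos : ∀ p, 0 < f p)
    {P U : ∀ x : B × F, TangentSpace (I.prod J) x} (hPB : TangentToBase I J P)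
    (hUF : TangentToFibre I J U) {a b : ℝ}
    (hM : IsQuasiEinstein (I.prod J) (warpedMetric I J gB.inner gF.inner f) P a b U)
    (hb : b ≠ 0) (p p' : B) : f p = f p' := by
  obtain ⟨q⟩ := ‹Nonempty F›
  have hs : ∀ v w, chartMetric J gF.inner q (extChartAt J q q) v w =
      chartMetric J gF.inner q (extChartAt J q q) w v := fun v w => chartMetric_symm gF q _ v w
  have hp := (eventually_regularAt_chartMetric gF q).self_of_nhds.pos
  obtain ⟨c, hc, hc'⟩ := exists_orthonormal_expansion hs hp
  -- The same `q` and the same frame `c` serve both base points, so the two left-hand sides are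
  -- literally equal.
  obtain ⟨d, u, hu, h⟩ := exists_fibre_ricci_eq hf hfpos hPB hUF hM p q (by simp) c hc hc'
  obtain ⟨d', u', hu', h'⟩ := exists_fibre_ricci_eq hf hfpos hPB hUF hM p' q (by simp) c hc hc'
  have h1 := hfpos p
  have h2 := hfpos p'
  have hβ : 0 < b * f p ^ 2 * (b * f p' ^ 2) := by
    have : b * f p ^ 2 * (b * f p' ^ 2) = b ^ 2 * (f p ^ 2 * f p' ^ 2) := by ring
    rw [this]
    positivity
  have h3 := rankOne_coeff_unique hn hs hp (d := d' - d) hu hu' hβ fun v w => by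
    linear_combination (h v w).symm.trans (h' v w)
  exact (pow_left_inj₀ h1.le h2.le two_ne_zero).1 (mul_left_cancel₀ hb h3)

end Fibre

end WarpedSemiSymm

end

theorem theorem3p9 {n₁ n₂ : ℕ} (hn₁ : 2 ≤ n₁) (hn₂ : 2 ≤ n₂)
    {B : Type*} [TopologicalSpace B] [ChartedSpace (EuclideanSpace ℝ (Fin n₁)) B]
    [IsManifold (𝓡 n₁) ∞ B]
    {F : Type*} [TopologicalSpace F] [ChartedSpace (EuclideanSpace ℝ (Fin n₂)) F]
    [IsManifold (𝓡 n₂) ∞ F] [Nonempty F]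
    (gB : ContMDiffRiemannianMetric (𝓡 n₁) ∞ (EuclideanSpace ℝ (Fin n₁))
      (fun p : B => TangentSpace (𝓡 n₁) p))
    (gF : ContMDiffRiemannianMetric (𝓡 n₂) ∞ (EuclideanSpace ℝ (Fin n₂))
      (fun q : F => TangentSpace (𝓡 n₂) q))
    (f : B → ℝ) (hf : ContMDiff (𝓡 n₁) 𝓘(ℝ, ℝ) ∞ f) (hfpos : ∀ p, 0 < f p)
    (P U : ∀ x : B × F, TangentSpace ((𝓡 n₁).prod (𝓡 n₂)) x)
    (hP : WarpedSemiSymm.IsSmoothField ((𝓡 n₁).prod (𝓡 n₂)) P)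
    (hPB : WarpedSemiSymm.TangentToBase (𝓡 n₁) (𝓡 n₂) P)
    (hUF : WarpedSemiSymm.TangentToFibre (𝓡 n₁) (𝓡 n₂) U)
    (a b : ℝ)
    (hM : WarpedSemiSymm.IsQuasiEinstein ((𝓡 n₁).prod (𝓡 n₂))
      (WarpedSemiSymm.warpedMetric (𝓡 n₁) (𝓡 n₂) gB.inner gF.inner f) P a b U)
    (hb : b ≠ 0) :
    WarpedSemiSymm.IsSimplyRiemannianProduct f := by
  -- Over an empty base any constant works.
  rcases isEmpty_or_nonempty B with hB | ⟨⟨p₀⟩⟩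
  · exact ⟨0, fun p => hB.elim p⟩
  · refine ⟨f p₀, fun p => ?_⟩
    exact WarpedSemiSymm.warp_constant (by simpa using hn₂) hf hfpos hPB hUF hM hb p p₀
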